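/- Let $k\ge 2$ be an integer and let $C_{k,n}=\frac{1}{kn+1}\binom{(k+1)n}{n}$, $n=0,1,2,\ldots$, be the Fuss--Catalan numbers of order $k$. A sequence $\{m_n\}_{n\ge 0}$ of real numbers is called a Stieltjes moment sequence if there is a nonnegative measure $\mu$ on $[0,\infty)$ with $m_n=\int_{[0,\infty)}x^n\,d\mu(x)$ for all $n\ge 0$; it is called S-determinate if there is exactly one such $\mu$; and it is called an infinitely divisible Stieltjes moment sequence if $\{m_n^c\}_{n\ge 0}$ is a Stieltjes moment sequence for every real $c>0$. Then: (a) $\{C_{k,n}\}_{n\ge 0}$ is an infinitely divisible Stieltjes moment sequence. (b) For each real $c>0$, the power sequence $\{C_{k,n}^c\}_{n\ge 0}$ is S-determinate. (c) For each real $c>0$, the measure $\mu_{k,c}$ on $[0,\infty)$ with moment sequence $\{C_{k,n}^c\}_{n\ge 0}$ has the Mellin transform $$\int_{[0,\infty)}t^s\,d\mu_{k,c}(t)=\left(\frac{1}{ks+1}\cdot\frac{\Gamma((k+1)s+1)}{\Gamma(s+1)\,\Gamma(ks+1)}\right)^c,\qquad s\ge 0 .$$ -/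

import Mathlib

open MeasureTheory

/-- The measure `μ` is concentrated on `[0, ∞)`, has finite moments of all orders, and its
moment sequence is `m`. -/
structure HasStieltjesMoments (μ : Measure ℝ) (m : ℕ → ℝ) : Prop where
  concentrated : μ (Set.Iio 0) = 0
  integrable_pow : ∀ n : ℕ, Integrable (fun x : ℝ => x ^ n) μ
  integral_pow : ∀ n : ℕ, ∫ x, x ^ n ∂μ = m n

/-- `m` is a Stieltjes moment sequence: some nonnegative measure on `[0, ∞)` has the moments `m`. -/
def IsStieltjesMomentSeq (m : ℕ → ℝ) : Prop :=
  ∃ μ : Measure ℝ, HasStieltjesMoments μ m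

/-- `m` is Stieltjes determinate: it is a Stieltjes moment sequence whose representing measure on
`[0, ∞)` is unique. -/
def IsStieltjesDeterminate (m : ℕ → ℝ) : Prop :=
  ∃! μ : Measure ℝ, HasStieltjesMoments μ m

/-- `m` is an infinitely divisible Stieltjes moment sequence: for every real `c > 0` the `c`-th
power of `m` is a Stieltjes moment sequence. (The case `c = 1` forces `m n ≥ 0` for all `n`.) -/
def IsInfinitelyDivisibleStieltjes (m : ℕ → ℝ) : Prop :=
  ∀ c : ℝ, 0 < c → IsStieltjesMomentSeq (fun n => m n ^ c)

/-- The Fuss–Catalan numbers of order `k`. -/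
noncomputable def fussCatalan (k n : ℕ) : ℝ :=
  (((k + 1) * n).choose n : ℝ) / ((k : ℝ) * n + 1)

/-! Interpolate the sequence by Gamma functions and divide by `R ^ s`, with `R` the exponential
growth rate, to get `φ` with `φ 0 = 1` and `φ (s + 1) = φ s * ∏ (aᵢ + s) / (bᵢ + s)`, where `aᵢ = (i
+ 1) / (k + 1) ≤ bᵢ = (i + 2) / k`. Since `φ (s + N) / φ N → 1`, iteration writes `φ s` as an
infinite product of factors `a (b + s) / (b (a + s))` with `a ≤ b`. Every power `c ≥ 0` of such a
factor is the Mellin transform of a probability measure on `[0, 1]` (`rpow_ratio`); such transforms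
are stable under products and pointwise limits, so `φ ^ c` is one too. Rescaling to `[0, R ^ c]`
yields a representing measure with the required Mellin transform. The moments are then at most `(R ^
c) ^ n`, so every representing measure lives on `[0, R ^ c]` and Weierstrass approximation makes it
unique. Hence the Mellin formula holds for any representing measure. -/

/-- `φ` is on `[0, ∞)` the Mellin transform of a probability measure on `[0, 1]`. -/
def IsUnitMellin (φ : ℝ → ℝ) : Prop :=
  ∃ μ : ProbabilityMeasure unitInterval, ∀ s : ℝ, 0 ≤ s →
    ∫ x, (x : ℝ) ^ s ∂(μ : Measure unitInterval) = φ s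

theorem continuous_unitInterval_rpow {s : ℝ} (hs : 0 ≤ s) :
    Continuous (fun x : unitInterval => (x : ℝ) ^ s) :=
  continuous_subtype_val.rpow_const fun _ => Or.inr hs

theorem integrable_unitInterval_rpow (μ : Measure unitInterval) [IsFiniteMeasure μ] {s : ℝ}
    (hs : 0 ≤ s) : Integrable (fun x : unitInterval => (x : ℝ) ^ s) μ :=
  (BoundedContinuousFunction.mkOfCompact
    ⟨fun x : unitInterval => (x : ℝ) ^ s, continuous_unitInterval_rpow hs⟩).integrable μ

/-! ### Mellin transforms of probability measures on the unit interval -/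

namespace IsUnitMellin

theorem congr {φ ψ : ℝ → ℝ} (h : IsUnitMellin φ) (e : ∀ s, 0 ≤ s → φ s = ψ s) :
    IsUnitMellin ψ := by
  obtain ⟨μ, hμ⟩ := h
  exact ⟨μ, fun s hs => (hμ s hs).trans (e s hs)⟩

theorem one : IsUnitMellin fun _ => 1 :=
  ⟨⟨Measure.dirac 1, inferInstance⟩, fun s _ => by simp⟩

/-- Multiplicative convolution: the law of a product of independent variables. -/
theorem mul {φ ψ : ℝ → ℝ} (hφ : IsUnitMellin φ) (hψ : IsUnitMellin ψ) :
    IsUnitMellin fun s => φ s * ψ s := by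
  obtain ⟨μ, hμ⟩ := hφ
  obtain ⟨ν, hν⟩ := hψ
  have hm : Measurable fun p : unitInterval × unitInterval => p.1 * p.2 :=
    continuous_mul.measurable
  refine ⟨⟨((μ : Measure unitInterval).prod ν).map fun p => p.1 * p.2,
    Measure.isProbabilityMeasure_map hm.aemeasurable⟩, fun s hs => ?_⟩
  beta_reduce
  rw [ProbabilityMeasure.coe_mk, integral_map hm.aemeasurable
    (continuous_unitInterval_rpow hs).measurable.aestronglyMeasurable, ← hμ s hs, ← hν s hs,
    ← integral_prod_mul]
  congr 1 with p
  simp [Real.mul_rpow p.1.2.1 p.2.2.1]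

theorem prod {ι : Type*} (t : Finset ι) {φ : ι → ℝ → ℝ} (h : ∀ i ∈ t, IsUnitMellin (φ i)) :
    IsUnitMellin fun s => ∏ i ∈ t, φ i s := by
  classical
  induction t using Finset.induction_on with
  | empty => simpa using one
  | insert i t hi ih =>
    simp only [Finset.prod_insert hi]
    exact (h i (by simp)).mul (ih fun j hj => h j (by simp [hj]))

theorem pow {φ : ℝ → ℝ} (h : IsUnitMellin φ) (n : ℕ) : IsUnitMellin fun s => φ s ^ n := by
  simpa using prod (Finset.range n) (φ := fun _ => φ) fun _ _ => h

theorem convexComb {φ ψ : ℝ → ℝ} (hφ : IsUnitMellin φ) (hψ : IsUnitMellin ψ) {p : ℝ}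
    (hp₀ : 0 ≤ p) (hp₁ : p ≤ 1) : IsUnitMellin fun s => p * φ s + (1 - p) * ψ s := by
  obtain ⟨μ, hμ⟩ := hφ
  obtain ⟨ν, hν⟩ := hψ
  refine ⟨⟨ENNReal.ofReal p • (μ : Measure unitInterval) + ENNReal.ofReal (1 - p) • ν,
    ⟨?_⟩⟩, fun s hs => ?_⟩
  · simp [← ENNReal.ofReal_add hp₀ (sub_nonneg.2 hp₁)]
  · rw [ProbabilityMeasure.coe_mk, integral_add_measure, integral_smul_measure,
      integral_smul_measure, hμ s hs, hν s hs, ENNReal.toReal_ofReal hp₀,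
      ENNReal.toReal_ofReal (sub_nonneg.2 hp₁)]
    · rfl
    · exact (integrable_unitInterval_rpow _ hs).smul_measure ENNReal.ofReal_ne_top
    · exact (integrable_unitInterval_rpow _ hs).smul_measure ENNReal.ofReal_ne_top

/-- Probability measures on `[0, 1]` form a weakly compact space, and `x ^ s` is a continuous test
function for `s ≥ 0`. -/
theorem of_tendsto {φ : ℕ → ℝ → ℝ} {ψ : ℝ → ℝ}
    (h : ∀ᶠ n in Filter.atTop, IsUnitMellin (φ n))
    (hlim : ∀ s, 0 ≤ s → Filter.Tendsto (fun n => φ n s) Filter.atTop (nhds (ψ s))) :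
    IsUnitMellin ψ := by
  obtain ⟨N, hN⟩ := Filter.eventually_atTop.1 h
  choose μ hμ using fun n => hN (n + N) (Nat.le_add_left _ _)
  -- A limit along a nonprincipal ultrafilter replaces a convergent subsequence.
  let U : Ultrafilter (ProbabilityMeasure unitInterval) := (Filter.hyperfilter ℕ).map μ
  refine ⟨U.lim, fun s hs => ?_⟩
  have hU : Filter.Tendsto μ (Filter.hyperfilter ℕ) (nhds U.lim) := U.le_nhds_lim
  have h₁ := (ProbabilityMeasure.tendsto_iff_forall_integral_tendsto.1 hU)
    (BoundedContinuousFunction.mkOfCompact ⟨_, continuous_unitInterval_rpow hs⟩)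
  have h₂ : Filter.Tendsto (fun n => φ (n + N) s) (Filter.hyperfilter ℕ) (nhds (ψ s)) :=
    ((Filter.tendsto_add_atTop_iff_nat N).2 (hlim s hs)).mono_left Nat.hyperfilter_le_atTop
  refine tendsto_nhds_unique h₁ (h₂.congr fun n => (hμ n s hs).symm)

/-- Compound Poisson law: the limit of `n`-th powers of the mixtures `(l / n) φ + (1 - l / n)`,
which are genuine once `n ≥ l`. -/
theorem exp_sub_one {φ : ℝ → ℝ} (h : IsUnitMellin φ) {l : ℝ} (hl : 0 ≤ l) :
    IsUnitMellin fun s => Real.exp (l * (φ s - 1)) := by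
  refine of_tendsto (φ := fun n s => (1 + l * (φ s - 1) / n) ^ n) ?_
    fun s _ => Real.tendsto_one_add_div_pow_exp _
  filter_upwards [Filter.eventually_ge_atTop (⌈l⌉₊ + 1)] with n hn
  have hn' : l ≤ n := (Nat.le_ceil l).trans (by exact_mod_cast (Nat.le_succ _).trans hn)
  have hn₀ : (0 : ℝ) < n := by exact_mod_cast (Nat.succ_pos _).trans_le hn
  refine ((h.convexComb one (p := l / n) (by positivity) (by rwa [div_le_one hn₀])).congr
    fun s _ => ?_).pow n
  ring

/-- The law of `U ^ (1 / b)` with `U` uniform on `[0, 1]`. -/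
theorem div_add {b : ℝ} (hb : 0 < b) : IsUnitMellin fun s => b / (b + s) := by
  have hm : Measurable fun x : unitInterval =>
      (⟨(x : ℝ) ^ (1 / b), Real.rpow_nonneg x.2.1 _,
        Real.rpow_le_one x.2.1 x.2.2 (by positivity)⟩ : unitInterval) :=
    (continuous_unitInterval_rpow (by positivity)).measurable.subtype_mk
  refine ⟨⟨(volume : Measure unitInterval).map _,
    Measure.isProbabilityMeasure_map hm.aemeasurable⟩, fun s hs => ?_⟩
  rw [ProbabilityMeasure.coe_mk, integral_map hm.aemeasurable
    (continuous_unitInterval_rpow hs).measurable.aestronglyMeasurable]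
  have e : ∀ x : unitInterval, ((x : ℝ) ^ (1 / b)) ^ s = (x : ℝ) ^ (s / b) := fun x => by
    rw [← Real.rpow_mul x.2.1]; congr 1; ring
  have hsb : 0 ≤ s / b := by positivity
  simp only [e]
  change ∫ x : Set.Icc (0 : ℝ) 1, ((x : ℝ) ^ (s / b)) ∂(Measure.comap Subtype.val volume) = _
  rw [integral_subtype_comap measurableSet_Icc (fun x : ℝ => x ^ (s / b)),
    integral_Icc_eq_integral_Ioc, ← intervalIntegral.integral_of_le zero_le_one,
    integral_rpow (Or.inl (by linarith)), Real.one_rpow, Real.zero_rpow (by linarith)]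
  field_simp
  ring

/-- With `x = b / (b + s)` and `p = (b - a) / b`, the ratio is `(1 - p) / (1 - p x)`, whose
logarithm is `∑ pⁿ (xⁿ - 1) / n` over `n ≥ 1`. The coefficients are nonnegative because `a ≤ b`, so
the `c`-th power is a limit of products of compound Poisson transforms. -/
theorem rpow_ratio {a b c : ℝ} (ha : 0 < a) (hab : a ≤ b) (hc : 0 ≤ c) :
    IsUnitMellin fun s => (a * (b + s) / (b * (a + s))) ^ c := by
  have hb : 0 < b := ha.trans_le hab
  set p : ℝ := (b - a) / b with hp
  have hp₀ : 0 ≤ p := div_nonneg (by linarith) hb.le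
  have hp₁ : p < 1 := by rw [hp, div_lt_one hb]; linarith
  refine of_tendsto (φ := fun N s => ∏ n ∈ Finset.range N,
    Real.exp (c * p ^ (n + 1) / (n + 1) * ((b / (b + s)) ^ (n + 1) - 1)))
    (Filter.Eventually.of_forall fun N => prod _ fun n _ =>
      ((div_add hb).pow (n + 1)).exp_sub_one (by positivity)) fun s hs => ?_
  simp only [← Real.exp_sum]
  set x : ℝ := b / (b + s) with hx
  have hx₀ : 0 ≤ x := by positivity
  have hx₁ : x ≤ 1 := by rw [hx, div_le_one (by positivity)]; linarith
  have hpx : p * x < 1 := (mul_le_of_le_one_right hp₀ hx₁).trans_lt hp₁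
  have h₁ := Real.hasSum_pow_div_log_of_abs_lt_one (x := p) (by rwa [abs_of_nonneg hp₀])
  have h₂ := Real.hasSum_pow_div_log_of_abs_lt_one (x := p * x)
    (by rwa [abs_of_nonneg (by positivity)])
  have e₁ : 1 - p = a / b := by rw [hp]; field_simp; ring
  have e₂ : 1 - p * x = (a + s) / (b + s) := by rw [hp, hx]; field_simp; ring
  have has : 0 < a + s := by linarith
  have hbs : 0 < b + s := by linarith
  have e₃ : a * (b + s) / (b * (a + s)) = (a / b) / ((a + s) / (b + s)) := by field_simp
  have h₃ := ((h₂.sub h₁).mul_left c).tendsto_sum_nat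
  rw [e₁, e₂, neg_sub_neg, ← Real.log_div (by positivity) (by positivity), ← e₃, mul_comm c] at h₃
  rw [Real.rpow_def_of_pos (by positivity)]
  refine (Real.continuous_exp.tendsto _).comp (h₃.congr fun N => Finset.sum_congr rfl fun n _ => ?_)
  rw [mul_pow]; ring

end IsUnitMellin

/-! ### Gamma interpolation and its product formula -/

/-- The Gamma function interpolation of the Fuss–Catalan numbers. -/
noncomputable def fussCatalanGamma (k : ℕ) (s : ℝ) : ℝ :=
  Real.Gamma ((k + 1) * s + 1) / (Real.Gamma (s + 1) * Real.Gamma (k * s + 2))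

/-- The exponential growth rate of the Fuss–Catalan numbers. -/
noncomputable def fussCatalanGrowth (k : ℕ) : ℝ := ((k : ℝ) + 1) ^ (k + 1) / (k : ℝ) ^ k

theorem fussCatalanGrowth_pos {k : ℕ} (hk : 0 < k) : 0 < fussCatalanGrowth k := by
  unfold fussCatalanGrowth; positivity

theorem fussCatalanGamma_pos (k : ℕ) {s : ℝ} (hs : 0 ≤ s) : 0 < fussCatalanGamma k s := by
  unfold fussCatalanGamma
  have h₁ := Real.Gamma_pos_of_pos (s := (k + 1) * s + 1) (by positivity)
  have h₂ := Real.Gamma_pos_of_pos (s := s + 1) (by positivity)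
  have h₃ := Real.Gamma_pos_of_pos (s := k * s + 2) (by positivity)
  positivity

theorem fussCatalanGamma_eq (k : ℕ) {s : ℝ} (hs : 0 ≤ s) :
    fussCatalanGamma k s = 1 / ((k : ℝ) * s + 1) *
      (Real.Gamma (((k : ℝ) + 1) * s + 1) /
        (Real.Gamma (s + 1) * Real.Gamma ((k : ℝ) * s + 1))) := by
  have h : 0 < (k : ℝ) * s + 1 := by positivity
  have h₂ := (Real.Gamma_pos_of_pos (s := s + 1) (by positivity)).ne'
  have h₃ := (Real.Gamma_pos_of_pos h).ne'
  rw [fussCatalanGamma, show (k : ℝ) * s + 2 = k * s + 1 + 1 by ring, Real.Gamma_add_one h.ne']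
  field_simp

theorem fussCatalanGamma_natCast (k n : ℕ) : fussCatalanGamma k n = fussCatalan k n := by
  rw [fussCatalanGamma_eq k n.cast_nonneg, fussCatalan, Nat.cast_choose ℝ (by nlinarith),
    Real.Gamma_nat_eq_factorial,
    show ((k : ℝ) + 1) * n + 1 = (((k + 1) * n : ℕ) : ℝ) + 1 by push_cast; ring,
    show (k : ℝ) * n + 1 = ((k * n : ℕ) : ℝ) + 1 by push_cast; ring,
    Real.Gamma_nat_eq_factorial, Real.Gamma_nat_eq_factorial,
    show (k + 1) * n - n = k * n by rw [add_mul, one_mul, Nat.add_sub_cancel]]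
  ring

theorem Real.Gamma_add_natCast {x : ℝ} (hx : 0 < x) (n : ℕ) :
    Real.Gamma (x + n) = Real.Gamma x * ∏ j ∈ Finset.range n, (x + j) := by
  induction n with
  | zero => simp
  | succ n ih =>
    rw [Nat.cast_succ, ← add_assoc, Real.Gamma_add_one (by positivity), ih,
      Finset.prod_range_succ]
    ring

/-- Euler's limit for `Γ x`, whose denominator `x (x + 1) ⋯ (x + n)` is `Γ (x + n + 1) / Γ x`. The
case `x = 0` is apart since the argument divides by `Γ x`. -/
theorem Real.tendsto_Gamma_add_div {x : ℝ} (hx : 0 ≤ x) :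
    Filter.Tendsto (fun n : ℕ => Real.Gamma (n + 1 + x) / (Real.Gamma (n + 1) * (n : ℝ) ^ x))
      Filter.atTop (nhds 1) := by
  rcases hx.eq_or_lt with rfl | hx
  · refine tendsto_const_nhds.congr fun n => ?_
    rw [add_zero, Real.rpow_zero, mul_one,
      div_self (Real.Gamma_pos_of_pos (by positivity)).ne']
  · have hG := (Real.Gamma_pos_of_pos hx).ne'
    have h := (tendsto_const_nhds (x := Real.Gamma x)).div (Real.GammaSeq_tendsto_Gamma x) hG
    rw [div_self hG] at h
    refine h.congr fun n => ?_
    have e := Real.Gamma_add_natCast hx (n + 1)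
    rw [Pi.div_apply, Real.GammaSeq, div_div_eq_mul_div, ← e, Real.Gamma_nat_eq_factorial,
      mul_comm ((n : ℝ) ^ x)]
    congr 2
    push_cast; ring

theorem fussCatalanGamma_add_one {k : ℕ} (hk : 0 < k) {s : ℝ} (hs : 0 ≤ s) :
    fussCatalanGamma k (s + 1) = fussCatalanGamma k s * (fussCatalanGrowth k *
      ∏ i ∈ Finset.range k, (((i + 1) / (k + 1) + s) / ((i + 2) / k + s))) := by
  have hk' : (0 : ℝ) < k := by exact_mod_cast hk
  -- The last of the `k + 1` factors is a multiple of `s + 1` and will cancel against `Γ (s + 2) / Γ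
  -- (s + 1)`, leaving `k` factors above and `k` below.
  have e₁ : Real.Gamma ((k + 1) * (s + 1) + 1) = Real.Gamma ((k + 1) * s + 1) *
      ((k + 1) ^ (k + 1) * ((∏ i ∈ Finset.range k, ((i + 1) / (k + 1) + s)) * (s + 1))) := by
    rw [show ((k : ℝ) + 1) * (s + 1) + 1 = (k + 1) * s + 1 + ((k + 1 : ℕ) : ℝ) by push_cast; ring,
      Real.Gamma_add_natCast (by positivity), Finset.prod_range_succ, pow_succ]
    have : ∀ i ∈ Finset.range k, ((k : ℝ) + 1) * s + 1 + i = (k + 1) * ((i + 1) / (k + 1) + s) :=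
      fun i _ => by field_simp; ring
    rw [Finset.prod_congr rfl this, Finset.prod_mul_distrib, Finset.prod_const, Finset.card_range]
    ring
  have e₂ : Real.Gamma (k * (s + 1) + 2) = Real.Gamma (k * s + 2) *
      (k ^ k * ∏ i ∈ Finset.range k, ((i + 2) / k + s)) := by
    rw [show (k : ℝ) * (s + 1) + 2 = k * s + 2 + k by ring,
      Real.Gamma_add_natCast (by positivity)]
    have : ∀ i ∈ Finset.range k, (k : ℝ) * s + 2 + i = k * ((i + 2) / k + s) :=
      fun i _ => by field_simp; ring
    rw [Finset.prod_congr rfl this, Finset.prod_mul_distrib, Finset.prod_const, Finset.card_range]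
  have h₁ : 0 < s + 1 := by positivity
  have h₂ := Real.Gamma_pos_of_pos h₁
  have h₃ := Real.Gamma_pos_of_pos (s := k * s + 2) (by positivity)
  have h₄ : 0 < ∏ i ∈ Finset.range k, (((i : ℝ) + 2) / k + s) :=
    Finset.prod_pos fun i _ => by positivity
  rw [fussCatalanGamma, e₁, e₂, Real.Gamma_add_one h₁.ne', fussCatalanGamma, fussCatalanGrowth,
    Finset.prod_div_distrib]
  field_simp

/-- The Gamma function interpolation of the Fuss–Catalan numbers, divided by its exponential
growth. -/
noncomputable def fussCatalanNormalized (k : ℕ) (s : ℝ) : ℝ :=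
  fussCatalanGamma k s / fussCatalanGrowth k ^ s

theorem fussCatalanNormalized_pos {k : ℕ} (hk : 0 < k) {s : ℝ} (hs : 0 ≤ s) :
    0 < fussCatalanNormalized k s :=
  div_pos (fussCatalanGamma_pos k hs) (Real.rpow_pos_of_pos (fussCatalanGrowth_pos hk) _)

theorem fussCatalanNormalized_zero (k : ℕ) : fussCatalanNormalized k 0 = 1 := by
  simp [fussCatalanNormalized, fussCatalanGamma]

theorem fussCatalanNormalized_add_one {k : ℕ} (hk : 0 < k) {s : ℝ} (hs : 0 ≤ s) :
    fussCatalanNormalized k (s + 1) = fussCatalanNormalized k s *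
      ∏ i ∈ Finset.range k, (((i + 1) / (k + 1) + s) / ((i + 2) / k + s)) := by
  have hR := fussCatalanGrowth_pos hk
  have := Real.rpow_pos_of_pos hR s
  rw [fussCatalanNormalized, fussCatalanGamma_add_one hk hs, Real.rpow_add hR, Real.rpow_one,
    fussCatalanNormalized]
  field_simp

theorem fussCatalanNormalized_add_natCast {k : ℕ} (hk : 0 < k) {s : ℝ} (hs : 0 ≤ s) (N : ℕ) :
    fussCatalanNormalized k (s + N) = fussCatalanNormalized k s *
      ∏ m ∈ Finset.range N, ∏ i ∈ Finset.range k,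
        (((i + 1) / (k + 1) + m + s) / ((i + 2) / k + m + s)) := by
  induction N with
  | zero => simp
  | succ N ih =>
    rw [Nat.cast_succ, ← add_assoc, fussCatalanNormalized_add_one hk (by positivity), ih,
      Finset.prod_range_succ, mul_assoc]
    congr 3 with i
    rw [add_comm s, add_assoc, add_assoc]

theorem tendsto_fussCatalanNormalized_ratio {k : ℕ} (hk : 0 < k) {s : ℝ} (hs : 0 ≤ s) :
    Filter.Tendsto (fun N : ℕ => fussCatalanNormalized k (s + N) / fussCatalanNormalized k N)
      Filter.atTop (nhds 1) := by
  have hk' : (0 : ℝ) < k := by exact_mod_cast hk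
  have t₁ : Filter.Tendsto (fun N : ℕ => (k + 1) * N) Filter.atTop Filter.atTop :=
    Filter.tendsto_id.const_mul_atTop' (Nat.succ_pos k)
  have t₃ : Filter.Tendsto (fun N : ℕ => k * N + 1) Filter.atTop Filter.atTop :=
    (Filter.tendsto_add_atTop_nat 1).comp (Filter.tendsto_id.const_mul_atTop' hk)
  have h₁ := (Real.tendsto_Gamma_add_div (x := (k + 1) * s) (by positivity)).comp t₁
  have h₂ := Real.tendsto_Gamma_add_div hs
  have h₃ := (Real.tendsto_Gamma_add_div (x := k * s) (by positivity)).comp t₃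
  -- The shift by 2 in `Γ (k s + 2)` makes `h₃` normalize by powers of `k N + 1`; this corrects them
  -- to powers of `k N`, so that all powers of `N` cancel.
  have h₄ : Filter.Tendsto (fun N : ℕ => ((k * N : ℝ) / (k * N + 1)) ^ (k * s))
      Filter.atTop (nhds 1) := by
    have h := (tendsto_natCast_div_add_atTop (1 : ℝ)).comp
      (Filter.tendsto_id.const_mul_atTop' hk : Filter.Tendsto (fun N : ℕ => k * N) _ _)
    have := h.rpow_const (p := k * s) (Or.inl one_ne_zero)
    rw [Real.one_rpow] at this
    refine this.congr fun N => ?_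
    simp
  have h := (h₁.mul h₄).div (h₂.mul h₃) (by norm_num)
  rw [mul_one, div_one] at h
  refine h.congr' ?_
  filter_upwards [Filter.eventually_gt_atTop 0] with N hN
  have hN' : (0 : ℝ) < N := by exact_mod_cast hN
  have p₁ := Real.Gamma_pos_of_pos (s := ((k : ℝ) + 1) * N + 1) (by positivity)
  have p₂ := Real.Gamma_pos_of_pos (s := (N : ℝ) + 1) (by positivity)
  have p₃ := Real.Gamma_pos_of_pos (s := (k : ℝ) * N + 2) (by positivity)
  have q₁ := Real.Gamma_pos_of_pos (s := ((k : ℝ) + 1) * (s + N) + 1) (by positivity)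
  have q₂ := Real.Gamma_pos_of_pos (s := s + (N : ℝ) + 1) (by positivity)
  have q₃ := Real.Gamma_pos_of_pos (s := (k : ℝ) * (s + N) + 2) (by positivity)
  have hR := fussCatalanGrowth_pos hk
  have r₁ := Real.rpow_pos_of_pos hR s
  have r₂ := Real.rpow_pos_of_pos hR N
  have hRs : fussCatalanGrowth k ^ s = ((k : ℝ) + 1) ^ ((k + 1) * s) / (k : ℝ) ^ (k * s) := by
    rw [fussCatalanGrowth, Real.div_rpow (by positivity) (by positivity), ← Real.rpow_natCast,
      ← Real.rpow_natCast, ← Real.rpow_mul (by positivity), ← Real.rpow_mul (by positivity)]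
    push_cast; rfl
  have hN₁ : (N : ℝ) ^ ((k + 1) * s) = (N : ℝ) ^ (k * s) * (N : ℝ) ^ s := by
    rw [← Real.rpow_add hN']; ring_nf
  simp only [Pi.div_apply, Function.comp_apply, fussCatalanNormalized, fussCatalanGamma,
    Real.rpow_add hR, hRs]
  push_cast
  rw [show ((k : ℝ) + 1) * N + 1 + (k + 1) * s = (k + 1) * (s + N) + 1 by ring,
    show (N : ℝ) + 1 + s = s + N + 1 by ring,
    show (k : ℝ) * N + 1 + 1 + k * s = k * (s + N) + 2 by ring,
    show (k : ℝ) * N + 1 + 1 = k * N + 2 by ring,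
    Real.mul_rpow (by positivity) (by positivity), Real.div_rpow (by positivity) (by positivity),
    Real.mul_rpow (by positivity) (by positivity), hN₁]
  have u₁ : 0 < ((k : ℝ) + 1) ^ ((k + 1) * s) := by positivity
  have u₂ : 0 < (k : ℝ) ^ (k * s) := by positivity
  have u₃ : 0 < (N : ℝ) ^ (k * s) := by positivity
  have u₄ : 0 < (N : ℝ) ^ s := by positivity
  have u₅ : 0 < ((k : ℝ) * N + 1) ^ (k * s) := by positivity
  generalize ((k : ℝ) + 1) ^ ((k + 1) * s) = A at *
  generalize (k : ℝ) ^ (k * s) = B at *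
  generalize (N : ℝ) ^ (k * s) = C at *
  generalize (N : ℝ) ^ s = D at *
  generalize ((k : ℝ) * N + 1) ^ (k * s) = E at *
  generalize Real.Gamma (((k : ℝ) + 1) * N + 1) = F at *
  generalize Real.Gamma ((N : ℝ) + 1) = G at *
  generalize Real.Gamma ((k : ℝ) * N + 2) = H at *
  field_simp

theorem isUnitMellin_fussCatalanNormalized_rpow {k : ℕ} (hk : 0 < k) {c : ℝ} (hc : 0 ≤ c) :
    IsUnitMellin fun s => fussCatalanNormalized k s ^ c := by
  have hk' : (0 : ℝ) < k := by exact_mod_cast hk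
  refine IsUnitMellin.of_tendsto (φ := fun N s => ∏ m ∈ Finset.range N, ∏ i ∈ Finset.range k,
    (((i + 1 : ℝ) / (k + 1) + m) * ((i + 2) / k + m + s) /
      (((i + 2) / k + m) * ((i + 1) / (k + 1) + m + s))) ^ c)
    (Filter.Eventually.of_forall fun N => .prod _ fun m _ => .prod _ fun i _ =>
      .rpow_ratio (by positivity) ?_ hc) fun s hs => ?_
  -- The interlacing `aᵢ ≤ bᵢ`.
  · gcongr <;> linarith
  · have h := (tendsto_const_nhds (x := fussCatalanNormalized k s)).div
      (tendsto_fussCatalanNormalized_ratio hk hs) one_ne_zero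
    rw [div_one] at h
    refine (h.rpow_const (p := c) (Or.inr hc)).congr fun N => ?_
    have h₁ := fussCatalanNormalized_add_natCast hk hs N
    have h₂ := fussCatalanNormalized_add_natCast hk le_rfl N
    rw [zero_add, fussCatalanNormalized_zero, one_mul] at h₂
    have hh := (fussCatalanNormalized_pos hk hs).ne'
    simp only [Pi.div_apply]
    rw [h₁, h₂, div_div_eq_mul_div, mul_div_mul_left _ _ hh]
    simp only [add_zero, ← Finset.prod_div_distrib]
    rw [← Real.finsetProd_rpow _ _ fun m _ => Finset.prod_nonneg fun i _ => by positivity]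
    refine Finset.prod_congr rfl fun m _ => ?_
    rw [← Real.finsetProd_rpow _ _ fun i _ => by positivity]
    refine Finset.prod_congr rfl fun i _ => ?_
    rw [div_div_div_eq]

/-! ### Determinacy under exponential growth -/

namespace HasStieltjesMoments

theorem isFiniteMeasure {μ : Measure ℝ} {m : ℕ → ℝ} (h : HasStieltjesMoments μ m) :
    IsFiniteMeasure μ := by
  have := h.integrable_pow 0
  simpa [integrable_const_iff] using this

theorem ae_nonneg {μ : Measure ℝ} {m : ℕ → ℝ} (h : HasStieltjesMoments μ m) :
    ∀ᵐ x ∂μ, 0 ≤ x := by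
  simpa [ae_iff, Set.Iio] using h.concentrated

/-- Markov's inequality for `x ^ n` bounds the mass of `[L, ∞)` by `(K / L) ^ n`, which tends to 0
for `L > K`. -/
theorem ae_mem_Icc {μ : Measure ℝ} {m : ℕ → ℝ} (h : HasStieltjesMoments μ m) {K : ℝ}
    (hK : 0 < K) (hm : ∀ n, m n ≤ K ^ n) : ∀ᵐ x ∂μ, x ∈ Set.Icc 0 K := by
  have := h.isFiniteMeasure
  have key : ∀ L, K < L → μ {x | L ≤ x} = 0 := fun L hL => by
    have hL₀ : 0 < L := hK.trans hL
    have hle : ∀ n : ℕ, μ.real {x | L ≤ x} ≤ (K / L) ^ n := fun n => by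
      have h₁ := mul_meas_ge_le_integral_of_nonneg
        (h.ae_nonneg.mono fun x hx => pow_nonneg hx n) (h.integrable_pow n) (L ^ n)
      rw [h.integral_pow] at h₁
      have h₂ : μ.real {x | L ≤ x} ≤ μ.real {x | L ^ n ≤ x ^ n} :=
        measureReal_mono fun x (hx : L ≤ x) => pow_le_pow_left₀ hL₀.le hx n
      rw [div_pow, le_div_iff₀ (by positivity), mul_comm]
      exact ((mul_le_mul_of_nonneg_left h₂ (by positivity)).trans h₁).trans (hm n)
    have h0 : μ.real {x | L ≤ x} ≤ 0 := ge_of_tendsto'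
      (tendsto_pow_atTop_nhds_zero_of_lt_one (by positivity) ((div_lt_one hL₀).2 hL)) hle
    exact (measureReal_eq_zero_iff).1 (le_antisymm h0 measureReal_nonneg)
  have hlt : ∀ᵐ x ∂μ, ∀ j : ℕ, x < K + 1 / (j + 1) := ae_all_iff.2 fun j => by
    simpa [ae_iff] using key (K + 1 / (j + 1)) (by simpa using by positivity)
  filter_upwards [h.ae_nonneg, hlt] with x hx₀ hx
  refine ⟨hx₀, le_of_forall_pos_le_add fun ε hε => ?_⟩
  obtain ⟨j, hj⟩ := exists_nat_one_div_lt hε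
  exact (hx j).le.trans (by linarith)

theorem integrable_polynomial {μ : Measure ℝ} {m : ℕ → ℝ} (h : HasStieltjesMoments μ m)
    (p : Polynomial ℝ) : Integrable (fun x => p.eval x) μ := by
  simp only [Polynomial.eval_eq_sum_range]
  exact integrable_finsetSum _ fun i _ => (h.integrable_pow i).const_mul _

theorem integral_polynomial {μ : Measure ℝ} {m : ℕ → ℝ} (h : HasStieltjesMoments μ m)
    (p : Polynomial ℝ) :
    ∫ x, p.eval x ∂μ = ∑ i ∈ Finset.range (p.natDegree + 1), p.coeff i * m i := by
  simp only [Polynomial.eval_eq_sum_range]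
  rw [integral_finsetSum _ fun i _ => (h.integrable_pow i).const_mul _]
  simp only [integral_const_mul, h.integral_pow]

theorem abs_integral_sub_integral_polynomial_le {μ : Measure ℝ} {m : ℕ → ℝ}
    (h : HasStieltjesMoments μ m) {K ε : ℝ} (hμ : ∀ᵐ x ∂μ, x ∈ Set.Icc 0 K) {f : ℝ → ℝ}
    (hf : Integrable f μ) {p : Polynomial ℝ} (hp : ∀ x ∈ Set.Icc 0 K, |p.eval x - f x| < ε) :
    |∫ x, p.eval x ∂μ - ∫ x, f x ∂μ| ≤ ε * m 0 := by
  have := h.isFiniteMeasure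
  have h₀ : μ.real Set.univ = m 0 := by simpa using h.integral_pow 0
  rw [← integral_sub (h.integrable_polynomial p) hf, ← h₀]
  rw [← Real.norm_eq_abs]
  refine norm_integral_le_of_norm_le_const (hμ.mono fun x hx => ?_)
  exact (hp x hx).le

/-- A Stieltjes moment sequence of at most exponential growth has only one representing measure. -/
theorem eq_of_le_pow {μ ν : Measure ℝ} {m : ℕ → ℝ} (hμ : HasStieltjesMoments μ m)
    (hν : HasStieltjesMoments ν m) {K : ℝ} (hK : 0 < K) (hm : ∀ n, m n ≤ K ^ n) : μ = ν := by
  have := hμ.isFiniteMeasure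
  have := hν.isFiniteMeasure
  refine ext_of_forall_integral_eq_of_IsFiniteMeasure fun f => ?_
  rw [← sub_eq_zero, ← abs_nonpos_iff]
  refine le_of_forall_pos_le_add fun ε hε => ?_
  have hm₀ : 0 ≤ m 0 := by
    rw [← hμ.integral_pow 0]; exact integral_nonneg fun x => by simp
  -- Both measures give `p` the same integral, so two errors of at most `ε / 2` remain; the `+ 1`
  -- covers `m 0 = 0`.
  obtain ⟨p, hp⟩ := exists_polynomial_near_of_continuousOn 0 K f f.continuous.continuousOn
    (ε / (2 * (m 0 + 1))) (by positivity)
  have h₁ := hμ.abs_integral_sub_integral_polynomial_le (hμ.ae_mem_Icc hK hm) (f.integrable μ) hp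
  have h₂ := hν.abs_integral_sub_integral_polynomial_le (hν.ae_mem_Icc hK hm) (f.integrable ν) hp
  rw [hμ.integral_polynomial] at h₁
  rw [hν.integral_polynomial] at h₂
  have h₃ : ε / (2 * (m 0 + 1)) * m 0 ≤ ε / 2 := by
    rw [div_mul_eq_mul_div, div_le_div_iff₀ (by positivity) (by positivity)]
    nlinarith
  rw [abs_le] at h₁ h₂ ⊢
  constructor <;> linarith [h₁.1, h₁.2, h₂.1, h₂.2]

end HasStieltjesMoments

/-! ### Rescaling and conclusion -/

theorem IsUnitMellin.le_one {φ : ℝ → ℝ} (h : IsUnitMellin φ) {s : ℝ} (hs : 0 ≤ s) : φ s ≤ 1 := by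
  obtain ⟨μ, hμ⟩ := h
  rw [← hμ s hs]
  calc ∫ x, (x : ℝ) ^ s ∂(μ : Measure unitInterval) ≤ ∫ _, (1 : ℝ) ∂(μ : Measure unitInterval) :=
        integral_mono (integrable_unitInterval_rpow _ hs) (integrable_const _)
          fun x => Real.rpow_le_one x.2.1 x.2.2 hs
    _ = 1 := by simp

/-- Rescaling to `[0, K]` a measure on `[0, 1]` with Mellin transform `φ`. -/
theorem IsUnitMellin.exists_measure {φ : ℝ → ℝ} (h : IsUnitMellin φ) {K : ℝ} (hK : 0 < K) :
    ∃ μ : Measure ℝ, μ (Set.Iio 0) = 0 ∧ ∀ s : ℝ, 0 ≤ s →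
      Integrable (fun t : ℝ => t ^ s) μ ∧ ∫ t, t ^ s ∂μ = K ^ s * φ s := by
  obtain ⟨μ, hμ⟩ := h
  have hm : Measurable fun x : unitInterval => K * (x : ℝ) := measurable_subtype_coe.const_mul K
  have e : ∀ (s : ℝ) (x : unitInterval), (K * (x : ℝ)) ^ s = K ^ s * (x : ℝ) ^ s :=
    fun s x => Real.mul_rpow hK.le x.2.1
  refine ⟨(μ : Measure unitInterval).map fun x : unitInterval => K * (x : ℝ), ?_, fun s hs => ?_⟩
  · rw [Measure.map_apply hm measurableSet_Iio]
    convert measure_empty (μ := (μ : Measure unitInterval))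
    exact Set.eq_empty_of_forall_notMem fun x hx => (mul_nonneg hK.le x.2.1).not_gt hx
  · have hms : AEStronglyMeasurable (fun t : ℝ => t ^ s)
        ((μ : Measure unitInterval).map fun x : unitInterval => K * (x : ℝ)) :=
      (Real.continuous_rpow_const hs).aestronglyMeasurable
    constructor
    · rw [integrable_map_measure hms hm.aemeasurable]
      simp only [Function.comp_def, e]
      exact (integrable_unitInterval_rpow _ hs).const_mul _
    · rw [integral_map hm.aemeasurable hms]
      simp only [e]
      rw [integral_const_mul, hμ s hs]

theorem fussCatalanGamma_rpow_eq {k : ℕ} (hk : 0 < k) (c : ℝ) {s : ℝ} (hs : 0 ≤ s) :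
    fussCatalanGamma k s ^ c =
      (fussCatalanGrowth k ^ c) ^ s * fussCatalanNormalized k s ^ c := by
  have hR := fussCatalanGrowth_pos hk
  rw [← Real.rpow_mul hR.le, mul_comm c, Real.rpow_mul hR.le,
    ← Real.mul_rpow (by positivity) (fussCatalanNormalized_pos hk hs).le, fussCatalanNormalized,
    mul_div_cancel₀ _ (Real.rpow_pos_of_pos hR s).ne']

theorem exists_measure_fussCatalanGamma_rpow {k : ℕ} (hk : 0 < k) {c : ℝ} (hc : 0 ≤ c) :
    ∃ μ : Measure ℝ, HasStieltjesMoments μ (fun n => fussCatalan k n ^ c) ∧ ∀ s : ℝ, 0 ≤ s →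
      Integrable (fun t : ℝ => t ^ s) μ ∧ ∫ t, t ^ s ∂μ = fussCatalanGamma k s ^ c := by
  obtain ⟨μ, h₀, hμ⟩ := (isUnitMellin_fussCatalanNormalized_rpow hk hc).exists_measure
    (Real.rpow_pos_of_pos (fussCatalanGrowth_pos hk) c)
  refine ⟨μ, ⟨h₀, fun n => ?_, fun n => ?_⟩, fun s hs => ?_⟩
  · simpa only [Real.rpow_natCast] using (hμ n n.cast_nonneg).1
  · rw [← fussCatalanGamma_natCast, fussCatalanGamma_rpow_eq hk c n.cast_nonneg]
    simpa only [Real.rpow_natCast] using (hμ n n.cast_nonneg).2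
  · rw [fussCatalanGamma_rpow_eq hk c hs]
    exact hμ s hs

theorem fussCatalan_rpow_le {k : ℕ} (hk : 0 < k) {c : ℝ} (hc : 0 ≤ c) (n : ℕ) :
    fussCatalan k n ^ c ≤ (fussCatalanGrowth k ^ c) ^ n := by
  have hR := fussCatalanGrowth_pos hk
  rw [← fussCatalanGamma_natCast, fussCatalanGamma_rpow_eq hk c n.cast_nonneg, Real.rpow_natCast]
  exact mul_le_of_le_one_right (by positivity)
    ((isUnitMellin_fussCatalanNormalized_rpow hk hc).le_one n.cast_nonneg)

theorem theorem5 (k : ℕ) (hk : 2 ≤ k) :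
    IsInfinitelyDivisibleStieltjes (fussCatalan k) ∧
    (∀ c : ℝ, 0 < c → IsStieltjesDeterminate (fun n => fussCatalan k n ^ c)) ∧
    (∀ c : ℝ, 0 < c → ∀ μ : Measure ℝ, HasStieltjesMoments μ (fun n => fussCatalan k n ^ c) →
      ∀ s : ℝ, 0 ≤ s →
        Integrable (fun t : ℝ => t ^ s) μ ∧
        ∫ t, t ^ s ∂μ =
          (1 / ((k : ℝ) * s + 1) *
            (Real.Gamma (((k : ℝ) + 1) * s + 1) /
              (Real.Gamma (s + 1) * Real.Gamma ((k : ℝ) * s + 1)))) ^ c) := by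
  have hk₀ : 0 < k := two_pos.trans_le hk
  have unique : ∀ c : ℝ, 0 < c → ∀ μ ν : Measure ℝ,
      HasStieltjesMoments μ (fun n => fussCatalan k n ^ c) →
      HasStieltjesMoments ν (fun n => fussCatalan k n ^ c) → μ = ν := fun c hc μ ν hμ hν =>
    hμ.eq_of_le_pow hν (Real.rpow_pos_of_pos (fussCatalanGrowth_pos hk₀) c)
      (fussCatalan_rpow_le hk₀ hc.le)
  refine ⟨fun c hc => ?_, fun c hc => ?_, fun c hc μ hμ s hs => ?_⟩
  · obtain ⟨μ, hμ, -⟩ := exists_measure_fussCatalanGamma_rpow hk₀ hc.le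
    exact ⟨μ, hμ⟩
  · obtain ⟨μ, hμ, -⟩ := exists_measure_fussCatalanGamma_rpow hk₀ hc.le
    exact ⟨μ, hμ, fun ν hν => unique c hc ν μ hν hμ⟩
  · obtain ⟨ν, hν, h⟩ := exists_measure_fussCatalanGamma_rpow hk₀ hc.le
    rw [unique c hc μ ν hμ hν, ← fussCatalanGamma_eq k hs]
    exact h s hs
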